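/- Define $A_0(j)=2j$ for $j\ge 0$, $A_k(0)=1$ for $k\ge 1$, and $A_k(j)=A_{k-1}(A_k(j-1))$ for $k,j\ge 1$, and let $\alpha(m,n)=\min\{s\ge 1 : A_s(4\lceil m/n\rceil)\ge \log_2 n\}$ be the two-parameter inverse Ackermann function. For a finite set $X\subset\mathbb R^d$ and $t\ge 1$, a (possibly Steiner) Euclidean $t$-spanner for $X$ is a graph $H=(V,E)$ with $X\subseteq V\subseteq\mathbb R^d$, each edge $(x,y)$ having weight $\|x-y\|$, such that every two distinct points $p,q\in X$ are joined in $H$ by a $t$-spanner path, i.e. a path of total weight at most $t\|p-q\|$. Its diameter is the maximum, over all pairs of distinct points $p,q\in X$, of the minimum number of edges of a $t$-spanner path between $p$ and $q$ in $H$. There is an absolute constant $c>0$ such that for every $\epsilon>0$ and every integer $n\ge 2$ there is a set $X$ of $n$ points on the $x$-axis with the following property: for every $d\ge 1$ (regarding the $x$-axis as the first coordinate axis of $\mathbb R^d$) and every integer $m \ge 0$, every (possibly Steiner) Euclidean $(1+\epsilon)$-spanner for $X$ in $\mathbb R^d$ with at most $m$ edges has diameter at least $c\cdot\alpha(m,n)$.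 (No such spanner exists for $m=0$; for $m\ge1$ the minimum defining $\alpha(m,n)$ exists.) -/

import Mathlib

open scoped ENNReal

/-- The rapidly growing functions `A_k(n)`: `A_0(n) = 2n`, `A_k(0) = 1` for `k ≥ 1`, and
`A_k(n) = A_{k-1}(A_k(n-1))` for `k, n ≥ 1`.  Also written `A(k, n)`. -/
def ackA : ℕ → ℕ → ℕ
  | 0, n => 2 * n
  | _ + 1, 0 => 1
  | k + 1, n + 1 => ackA k (ackA (k + 1) n)

/-- The two-parameter inverse Ackermann function
`α(m, n) = min {s ≥ 1 : A(s, 4⌈m/n⌉) ≥ log₂ n}`.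
(The set is nonempty whenever `m, n ≥ 1`.) -/
noncomputable def invAck (m n : ℕ) : ℕ :=
  sInf {s : ℕ | 1 ≤ s ∧ Real.logb 2 (n : ℝ) ≤ (ackA s (4 * ⌈(m : ℝ) / (n : ℝ)⌉₊) : ℝ)}

section Geometric

variable {P : Type*} [MetricSpace P] {V : Set P}

/-- The weight of a walk in a geometric graph on a set `V` of points: the sum of the
distances between the endpoints of its edges. -/
noncomputable def walkWeight {H : SimpleGraph V} {u v : V} (w : H.Walk u v) : ℝ :=
  (w.darts.map fun e => dist (e.fst : P) (e.snd : P)).sum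

/-- A `t`-spanner path between `u` and `v`: a path whose weight is at most `t` times the distance
between `u` and `v`. -/
def IsSpannerPath {H : SimpleGraph V} (t : ℝ) {u v : V} (w : H.Walk u v) : Prop :=
  w.IsPath ∧ walkWeight w ≤ t * dist (u : P) (v : P)

/-- The geometric graph `H` with vertex set `V` is a (possibly Steiner) `t`-spanner for `X`:
`X ⊆ V`, and every two distinct points of `X` are joined by a `t`-spanner path in `H`.
The points of `V \ X` are the Steiner points; `V = X` gives an ordinary spanner. -/
structure IsSteinerSpanner (t : ℝ) (X : Set P) (H : SimpleGraph V) : Prop where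
  subset : X ⊆ V
  exists_path : ∀ p q : V, (p : P) ∈ X → (q : P) ∈ X → p ≠ q →
    ∃ w : H.Walk p q, IsSpannerPath t w

/-- The diameter of a `t`-spanner `H` for `X`: the maximum, over pairs of distinct points of `X`,
of the minimum number of edges of a `t`-spanner path between them. -/
noncomputable def spannerDiameter (t : ℝ) (X : Set P) (H : SimpleGraph V) : ℕ∞ :=
  ⨆ (p : V) (q : V) (_ : (p : P) ∈ X) (_ : (q : P) ∈ X) (_ : p ≠ q),
    ⨅ (w : H.Walk p q) (_ : IsSpannerPath t w), (w.length : ℕ∞)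

end Geometric

/-- A set of reals, placed on the `x`-axis (the first coordinate axis) of `ℝ^d`. -/
def onXAxis (d : ℕ) [NeZero d] (X : Set ℝ) : Set (EuclideanSpace ℝ (Fin d)) :=
  (fun x : ℝ => EuclideanSpace.single (0 : Fin d) x) '' X

/-!
The points of `X` have as base `R` digits, with `R` large compared with `t`, the binary digits of
`0, …, n - 1`. A dyadic block of indices is then so far from the other points, relative to its
diameter, that moving every vertex of a `t`-spanner path (Steiner or not) to the nearest point of
`X` leaves it in each dyadic block containing both ends of the path. Hence a `t`-spanner with `m`
edges and diameter `k` gives at most `m` edges on `0, …, n - 1` that connect any two elements of a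
dyadic block by `k` hops inside the block.

Such an edge set must be large. Cut a block of length `2 ^ (b + g)` into blocks of length `2 ^ b`.
If there are few edges across the cuts, then most elements lie on none of them. For these elements
the first and the last hop stay in their blocks, so contracting the blocks yields a `(k - 2)`-hop
edge set on `2 ^ g` elements, which has few edges per contracted block only if `g` is small.
Otherwise the crossing edges add a constant to the average degree that is already forced inside
the blocks of length `2 ^ b`. The depth needed for average degree `j` with `k` hops therefore
satisfies an Ackermann-like recursion in `(k, j)`.
-/

/-! ### The Ackermann hierarchy -/

theorem two_mul_le_ackA (k n : ℕ) : 2 * n ≤ ackA k n := by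
  fun_induction ackA k n with
  | case1 => exact le_rfl
  | case2 => exact Nat.zero_le _
  | case3 k n ihn ihk =>
    rcases n.eq_zero_or_pos with rfl | hn
    · simpa only [ackA] using ihk
    · omega

theorem lt_ackA_succ_left (k n : ℕ) : n < ackA (k + 1) n := by
  cases n with
  | zero => simp [ackA]
  | succ n =>
    have := two_mul_le_ackA (k + 1) (n + 1)
    omega

theorem ackA_succ_succ (k n : ℕ) : ackA (k + 1) (n + 1) = ackA k (ackA (k + 1) n) := by
  rw [ackA]

theorem two_mul_ackA_le_ackA_succ (k n : ℕ) : 2 * ackA (k + 1) n ≤ ackA (k + 1) (n + 1) := by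
  rw [ackA]
  exact two_mul_le_ackA k _

theorem ackA_strictMono (k : ℕ) : StrictMono (ackA k) := by
  refine strictMono_nat_of_lt_succ fun n => ?_
  cases k with
  | zero => simp [ackA]
  | succ k =>
    have hpos := lt_ackA_succ_left k n
    have hdouble := two_mul_ackA_le_ackA_succ k n
    omega

theorem ackA_mono_left (n : ℕ) : Monotone fun k => ackA k n := by
  refine monotone_nat_of_le_succ fun k => ?_
  cases n with
  | zero => cases k <;> simp [ackA]
  | succ n =>
    rw [ackA]
    exact (ackA_strictMono k).monotone (lt_ackA_succ_left k n)

theorem ackA_add_le (k n y : ℕ) : ackA k n + y ≤ ackA k (n + y) := by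
  induction y with
  | zero => rfl
  | succ y ih =>
    have : ackA k (n + y) < ackA k (n + (y + 1)) := ackA_strictMono k (by omega)
    omega

theorem ackA_one_right (k : ℕ) : ackA k 1 = 2 := by
  induction k with
  | zero => rw [ackA]
  | succ k ih => rwa [ackA_succ_succ, ackA]

theorem ackA_two_right (k : ℕ) : ackA k 2 = 4 := by
  induction k with
  | zero => rw [ackA]
  | succ k ih => rwa [ackA_succ_succ, ackA_one_right]

theorem two_pow_add_le_ackA_two {n : ℕ} (hn : 3 ≤ n) : 2 ^ n + n + 1 ≤ ackA 2 n := by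
  induction n, hn using Nat.le_induction with
  | base => simp [ackA]
  | succ n _ ih =>
    have hdouble : 2 * ackA 2 n ≤ ackA 2 (n + 1) := two_mul_ackA_le_ackA_succ 1 n
    rw [pow_succ]
    omega

theorem mul_le_ackA_three (M : ℕ) : 18 * (M + 1) ≤ ackA 3 (4 * M + 3) := by
  induction M with
  | zero =>
    calc 18 * (0 + 1) ≤ 2 ^ 4 + 4 + 1 := by norm_num
      _ ≤ ackA 2 4 := two_pow_add_le_ackA_two (by norm_num)
      _ = ackA 3 3 := by rw [ackA_succ_succ 2, ackA_two_right]
  | succ M ih =>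
    calc 18 * (M + 1 + 1) ≤ 2 * ackA 3 (4 * M + 3) := by omega
      _ ≤ ackA 3 (4 * M + 4) := two_mul_ackA_le_ackA_succ 2 _
      _ ≤ ackA 3 (4 * (M + 1) + 3) := (ackA_strictMono 3).monotone (by omega)

/-- A depth of the dyadic hierarchy that forces every `2 * i`-hop spanner of it to have average
degree proportional to `j`. The recursion follows `ForcesDegree.succ`: a set whose blocks of length
`2 ^ b` already force degree `j` gains one more unit of degree from the edges between blocks. -/
def hopDepth : ℕ → ℕ → ℕ
  | 0, _ => 1
  | _ + 1, 0 => 0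
  | i + 1, j + 1 => hopDepth (i + 1) j + hopDepth i (2 ^ (hopDepth (i + 1) j + 1))

theorem hopDepth_add_two_le_ackA (i j : ℕ) : hopDepth i j + 2 ≤ ackA (2 * i + 1) (j + 2) := by
  have four_le_ackA (k j : ℕ) : 4 ≤ ackA k (j + 2) := by
    rw [← ackA_two_right k]
    exact (ackA_strictMono k).monotone (by omega)
  fun_induction hopDepth i j with
  | case1 j => exact le_trans (by norm_num) (four_le_ackA _ _)
  | case2 i => exact le_trans (by norm_num) (four_le_ackA _ _)
  | case3 i j ihj ihi =>
    set b := hopDepth (i + 1) j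
    obtain ⟨z, hz⟩ : ∃ z, ackA (2 * i + 3) (j + 2) = z + 1 :=
      Nat.exists_eq_add_of_le' ((four_le_ackA _ _).trans' (by norm_num))
    have hz_three : 3 ≤ z := by have := four_le_ackA (2 * i + 3) j; omega
    have hbz : b + 1 ≤ z := by rw [show 2 * (i + 1) + 1 = 2 * i + 3 by ring] at ihj; omega
    have hpow : 2 ^ (b + 1) ≤ 2 ^ z := Nat.pow_le_pow_right two_pos hbz
    have hargument : 2 ^ (b + 1) + 2 + b ≤ ackA (2 * i + 2) z :=
      calc 2 ^ (b + 1) + 2 + b ≤ 2 ^ z + z + 1 := by omega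
        _ ≤ ackA 2 z := two_pow_add_le_ackA_two hz_three
        _ ≤ ackA (2 * i + 2) z := ackA_mono_left z (by omega)
    calc b + hopDepth i (2 ^ (b + 1)) + 2
        ≤ ackA (2 * i + 1) (2 ^ (b + 1) + 2) + b := by omega
      _ ≤ ackA (2 * i + 1) (2 ^ (b + 1) + 2 + b) := ackA_add_le _ _ _
      _ ≤ ackA (2 * i + 1) (ackA (2 * i + 2) z) := (ackA_strictMono _).monotone hargument
      _ = ackA (2 * (i + 1) + 1) (j + 1 + 2) := by
        rw [← ackA_succ_succ, ← hz, ← ackA_succ_succ]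
        rfl

theorem hopDepth_le_ackA_four_mul (i : ℕ) {M : ℕ} (hM : M ≠ 0) :
    hopDepth i (16 * M) ≤ ackA (2 * i + 3) (4 * M) := by
  obtain ⟨M, rfl⟩ := Nat.exists_eq_succ_of_ne_zero hM
  have hargument : 16 * (M + 1) + 2 ≤ ackA (2 * i + 3) (4 * M + 3) :=
    calc 16 * (M + 1) + 2 ≤ 18 * (M + 1) := by omega
      _ ≤ ackA 3 (4 * M + 3) := mul_le_ackA_three M
      _ ≤ ackA (2 * i + 3) (4 * M + 3) := ackA_mono_left _ (by omega)
  calc hopDepth i (16 * (M + 1)) ≤ ackA (2 * i + 1) (16 * (M + 1) + 2) :=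
        (Nat.le_add_right _ 2).trans (hopDepth_add_two_le_ackA i _)
    _ ≤ ackA (2 * i + 2) (16 * (M + 1) + 2) := ackA_mono_left _ (by omega)
    _ ≤ ackA (2 * i + 2) (ackA (2 * i + 3) (4 * M + 3)) := (ackA_strictMono _).monotone hargument
    _ = ackA (2 * i + 3) (4 * (M + 1)) := (ackA_succ_succ _ _).symm

/-! ### Hop spanners of the dyadic hierarchy -/

/-- The vertices `x` and `y` are equal or joined by an edge of `E`. Allowing equality makes the
walks of exactly `k` hops the same as the walks of at most `k` edges. -/
def IsHop {α : Type*} (E : Finset (Sym2 α)) (x y : α) : Prop :=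
  x = y ∨ s(x, y) ∈ E

theorem IsHop.image {α β : Type*} [DecidableEq β] {E : Finset (Sym2 α)} {x y : α}
    (g : α → β) (h : IsHop E x y) : IsHop (E.image (Sym2.map g)) (g x) (g y) :=
  h.imp (congrArg g) fun hmem => Finset.mem_image_of_mem (Sym2.map g) hmem

/-- `E` is a `k`-hop spanner of `S ⊆ ℕ` with respect to the dyadic hierarchy on `ℕ`, whose blocks at
level `l` are the fibres of `· / 2 ^ l`: any two elements of `S` in a common block are
joined by a walk of at most `k` edges of `E` inside this block. -/
def IsHopSpanner (k : ℕ) (S : Finset ℕ) (E : Finset (Sym2 ℕ)) : Prop :=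
  ∀ p ∈ S, ∀ q ∈ S, ∀ l, p / 2 ^ l = q / 2 ^ l →
    ∃ f : ℕ → ℕ, f 0 = p ∧ f k = q ∧ (∀ i < k, IsHop E (f i) (f (i + 1))) ∧
      ∀ i ≤ k, f i / 2 ^ l = p / 2 ^ l

/-- The edges of `E` between different blocks of length `2 ^ b`. -/
def crossingEdges (b : ℕ) (E : Finset (Sym2 ℕ)) : Finset (Sym2 ℕ) :=
  {e ∈ E | ¬ (e.map (· / 2 ^ b)).IsDiag}

/-- The edges of `E` inside the block of length `2 ^ b` with index `c`. -/
def blockEdges (b c : ℕ) (E : Finset (Sym2 ℕ)) : Finset (Sym2 ℕ) :=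
  {e ∈ E | e.map (· / 2 ^ b) = Sym2.diag c}

theorem div_two_pow_add (x b g : ℕ) : x / 2 ^ (b + g) = x / 2 ^ b / 2 ^ g := by
  rw [pow_add, Nat.div_div_eq_div_mul]

theorem div_two_pow_eq_of_le {b l x y : ℕ} (hbl : b ≤ l) (h : x / 2 ^ b = y / 2 ^ b) :
    x / 2 ^ l = y / 2 ^ l := by
  obtain ⟨g, rfl⟩ := Nat.exists_eq_add_of_le hbl
  rw [div_two_pow_add, div_two_pow_add, h]

namespace IsHopSpanner

variable {k : ℕ} {S T : Finset ℕ} {E : Finset (Sym2 ℕ)}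

theorem mono (H : IsHopSpanner k S E) (hTS : T ⊆ S) : IsHopSpanner k T E :=
  fun p hp q hq => H p (hTS hp) q (hTS hq)

theorem filter_block (H : IsHopSpanner k S E) (b c : ℕ) :
    IsHopSpanner k {x ∈ S | x / 2 ^ b = c} (blockEdges b c E) := by
  intro p hp q hq l hpq
  rw [Finset.mem_filter] at hp hq
  have hpq_min : p / 2 ^ min l b = q / 2 ^ min l b := by
    rcases le_total l b with hlb | hbl
    · rwa [min_eq_left hlb]
    · rw [min_eq_right hbl, hp.2, hq.2]
  obtain ⟨f, h0, hk, hhop, hblock⟩ := H p hp.1 q hq.1 _ hpq_min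
  have hc : ∀ i ≤ k, f i / 2 ^ b = c := fun i hi =>
    (div_two_pow_eq_of_le (min_le_right l b) (hblock i hi)).trans hp.2
  refine ⟨f, h0, hk, fun i hi => (hhop i hi).imp_right fun hmem => ?_,
    fun i hi => div_two_pow_eq_of_le (min_le_left l b) (hblock i hi)⟩
  refine Finset.mem_filter.2 ⟨hmem, ?_⟩
  rw [Sym2.map_mk, hc i hi.le, hc (i + 1) hi, Sym2.diag]

/-- The first and the last hop of each walk stay in their blocks, so they are lost when
the blocks are contracted. -/
theorem contract {b : ℕ} (H : IsHopSpanner (k + 2) S E)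
    (hS : ∀ x ∈ S, ∀ e ∈ crossingEdges b E, x ∉ e) :
    IsHopSpanner k (S.image (· / 2 ^ b)) ((crossingEdges b E).image (Sym2.map (· / 2 ^ b))) := by
  have hop_cases {x y : ℕ} (hxy : IsHop E x y) :
      x / 2 ^ b = y / 2 ^ b ∨ s(x, y) ∈ crossingEdges b E := by
    rcases hxy with rfl | hmem
    · exact .inl rfl
    · by_cases hblock : x / 2 ^ b = y / 2 ^ b
      · exact .inl hblock
      · exact .inr (Finset.mem_filter.2 ⟨hmem, hblock⟩)
  intro P hP Q hQ l hPQ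
  obtain ⟨p, hp, rfl⟩ := Finset.mem_image.1 hP
  obtain ⟨q, hq, rfl⟩ := Finset.mem_image.1 hQ
  rw [← div_two_pow_add, ← div_two_pow_add] at hPQ
  obtain ⟨f, h0, hk, hhop, hblock⟩ := H p hp q hq (b + l) hPQ
  refine ⟨fun i => f (i + 1) / 2 ^ b, ?_, ?_, fun i hi => ?_, fun i hi => ?_⟩
  · have hfirst := hop_cases (hhop 0 (by omega))
    rw [h0] at hfirst
    exact (hfirst.resolve_right fun he => hS p hp _ he (Sym2.mem_mk_left _ _)).symm
  · have hlast := hop_cases (hhop (k + 1) (by omega))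
    rw [hk] at hlast
    exact hlast.resolve_right fun he => hS q hq _ he (Sym2.mem_mk_right _ _)
  · exact (hop_cases (hhop (i + 1) (by omega))).imp_right
      (Finset.mem_image_of_mem (Sym2.map (· / 2 ^ b)))
  · simpa only [div_two_pow_add] using hblock (i + 1) (by omega)

end IsHopSpanner

theorem card_le_of_div_eq {S : Finset ℕ} {d c : ℕ} (hd : d ≠ 0) (hS : ∀ x ∈ S, x / d = c) :
    S.card ≤ d := by
  have hsub : S ⊆ Finset.Ico (c * d) (c * d + d) := fun x hx => by
    rw [Finset.mem_Ico]
    have := (Nat.div_eq_iff (Nat.pos_of_ne_zero hd)).1 (hS x hx)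
    omega
  simpa using Finset.card_le_card hsub

theorem card_le_mul_card_image_div (S : Finset ℕ) {d : ℕ} (hd : d ≠ 0) :
    S.card ≤ d * (S.image (· / d)).card :=
  Finset.card_le_mul_card_image S d fun _ _ =>
    card_le_of_div_eq hd fun _ hx => (Finset.mem_filter.1 hx).2

theorem card_biUnion_toFinset_le {α : Type*} [DecidableEq α] (E : Finset (Sym2 α)) :
    (E.biUnion Sym2.toFinset).card ≤ E.card * 2 :=
  Finset.card_biUnion_le_card_mul E _ 2 fun e _ => by
    rw [Sym2.card_toFinset]
    split_ifs <;> norm_num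

theorem sum_card_blockEdges_add_card_crossingEdges_le (b : ℕ) (C : Finset ℕ)
    (E : Finset (Sym2 ℕ)) :
    ∑ c ∈ C, (blockEdges b c E).card + (crossingEdges b E).card ≤ E.card := by
  have hsum : ∑ c ∈ C, (blockEdges b c E).card
      = {e ∈ E | e.map (· / 2 ^ b) ∈ C.image Sym2.diag}.card := by
    rw [← Finset.sum_card_fiberwise_eq_card_filter, Finset.sum_image Sym2.diag_injective.injOn]
    rfl
  rw [hsum, crossingEdges,
    ← Finset.card_filter_add_card_filter_not (s := E) fun e => (e.map (· / 2 ^ b)).IsDiag]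
  gcongr with e
  intro he
  obtain ⟨c, -, hc⟩ := Finset.mem_image.1 he
  exact hc ▸ Sym2.diag_isDiag c

/-- Every `k`-hop spanner of a set `S` inside a block of length `2 ^ h` has at least
`j * (2 * |S| - 2 ^ h) / 8` edges: once `S` fills more than half of the block, the average degree is
at least of the order of `j`. -/
def ForcesDegree (k j h : ℕ) : Prop :=
  ∀ (a : ℕ) (S : Finset ℕ) (E : Finset (Sym2 ℕ)), (∀ x ∈ S, x / 2 ^ h = a) →
    IsHopSpanner k S E → j * (2 * S.card) ≤ j * 2 ^ h + 8 * E.card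

namespace ForcesDegree

variable {k j b g h : ℕ} {S : Finset ℕ} {E : Finset (Sym2 ℕ)}

theorem zero_hops (j : ℕ) (hh : h ≠ 0) : ForcesDegree 0 j h := by
  intro a S E hS H
  have hcard : S.card ≤ 1 := Finset.card_le_one.2 fun p hp q hq => by
    obtain ⟨f, h0, hk, -⟩ := H p hp q hq h ((hS p hp).trans (hS q hq).symm)
    exact h0.symm.trans hk
  calc j * (2 * S.card) ≤ j * 2 ^ h :=
        Nat.mul_le_mul_left j ((Nat.mul_le_mul_left 2 hcard).trans (Nat.le_self_pow hh 2))
    _ ≤ j * 2 ^ h + 8 * E.card := Nat.le_add_right _ _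

theorem zero_degree (k h : ℕ) : ForcesDegree k 0 h := by
  intro a S E _ _
  simp

theorem le_sum_card_blockEdges (hin : ForcesDegree k j b) (H : IsHopSpanner k S E)
    (hC : (S.image (· / 2 ^ b)).card ≤ 2 ^ g) :
    j * (2 * S.card) ≤
      j * 2 ^ (b + g) + 8 * ∑ c ∈ S.image (· / 2 ^ b), (blockEdges b c E).card := by
  set C := S.image (· / 2 ^ b)
  calc j * (2 * S.card) = ∑ c ∈ C, j * (2 * {x ∈ S | x / 2 ^ b = c}.card) := by
        rw [Finset.card_eq_sum_card_image (· / 2 ^ b) S, Finset.mul_sum, Finset.mul_sum]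
    _ ≤ ∑ c ∈ C, (j * 2 ^ b + 8 * (blockEdges b c E).card) :=
        Finset.sum_le_sum fun c _ =>
          hin c _ _ (fun _ hx => (Finset.mem_filter.1 hx).2) (H.filter_block b c)
    _ = j * (2 ^ b * C.card) + 8 * ∑ c ∈ C, (blockEdges b c E).card := by
        rw [Finset.sum_add_distrib, Finset.sum_const, Finset.mul_sum, smul_eq_mul]
        ring
    _ ≤ j * 2 ^ (b + g) + 8 * ∑ c ∈ C, (blockEdges b c E).card := by
        rw [pow_add]
        gcongr

/-- Deleting the endpoints of the crossing edges from `S` leaves a set to which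
`IsHopSpanner.contract` applies. -/
theorem le_card_crossingEdges (hout : ForcesDegree k (2 ^ (b + 1)) g) {a : ℕ}
    (hS : ∀ x ∈ S, x / 2 ^ (b + g) = a) (H : IsHopSpanner (k + 2) S E) :
    2 * S.card ≤ 2 ^ (b + g) + 8 * (crossingEdges b E).card := by
  set G := crossingEdges b E
  set U := G.biUnion Sym2.toFinset
  set T := S \ U
  have hcontract := (H.mono (T := T) Finset.sdiff_subset).contract (b := b) fun x hx e he hxe =>
    (Finset.mem_sdiff.1 hx).2 (Finset.mem_biUnion.2 ⟨e, he, Sym2.mem_toFinset.2 hxe⟩)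
  have hblock : ∀ y ∈ T.image (· / 2 ^ b), y / 2 ^ g = a := fun y hy => by
    obtain ⟨x, hx, rfl⟩ := Finset.mem_image.1 hy
    rw [← div_two_pow_add, hS x (Finset.mem_sdiff.1 hx).1]
  have hT : 4 * T.card ≤ 2 * 2 ^ (b + g) + 8 * G.card :=
    calc 4 * T.card ≤ 4 * (2 ^ b * (T.image (· / 2 ^ b)).card) := by
          gcongr
          exact card_le_mul_card_image_div T (by positivity)
      _ = 2 ^ (b + 1) * (2 * (T.image (· / 2 ^ b)).card) := by ring
      _ ≤ 2 ^ (b + 1) * 2 ^ g + 8 * (G.image (Sym2.map (· / 2 ^ b))).card :=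
          hout a _ _ hblock hcontract
      _ ≤ 2 ^ (b + 1) * 2 ^ g + 8 * G.card :=
          Nat.add_le_add_left (Nat.mul_le_mul_left 8 Finset.card_image_le) _
      _ = 2 * 2 ^ (b + g) + 8 * G.card := by ring
  have hST : S.card ≤ T.card + U.card := Finset.card_le_card_sdiff_add_card
  have hU : U.card ≤ G.card * 2 := card_biUnion_toFinset_le G
  omega

theorem succ (hin : ForcesDegree (k + 2) j b) (hout : ForcesDegree k (2 ^ (b + 1)) g) :
    ForcesDegree (k + 2) (j + 1) (b + g) := by
  intro a S E hS H
  have hC : (S.image (· / 2 ^ b)).card ≤ 2 ^ g :=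
    card_le_of_div_eq (c := a) (by positivity) fun y hy => by
      obtain ⟨x, hx, rfl⟩ := Finset.mem_image.1 hy
      rw [← div_two_pow_add, hS x hx]
  have hinner := hin.le_sum_card_blockEdges H hC
  have hcrossing := hout.le_card_crossingEdges hS H
  have hedges := sum_card_blockEdges_add_card_crossingEdges_le b (S.image (· / 2 ^ b)) E
  rw [add_one_mul, add_one_mul]
  omega

theorem of_hopDepth_le {i : ℕ} (hh : hopDepth i j ≤ h) : ForcesDegree (2 * i) j h := by
  induction i generalizing j h with
  | zero =>
    rw [hopDepth] at hh
    exact zero_hops j (by omega)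
  | succ i ihi =>
    induction j generalizing h with
    | zero => exact zero_degree _ _
    | succ j ihj =>
      rw [hopDepth] at hh
      obtain ⟨g, rfl⟩ := Nat.exists_eq_add_of_le ((Nat.le_add_right _ _).trans hh)
      exact (ihj le_rfl).succ (ihi (Nat.le_of_add_le_add_left hh))

end ForcesDegree

theorem IsHopSpanner.invAck_le {i m n : ℕ} {E : Finset (Sym2 ℕ)} (hn : n ≠ 0) (hm : m ≠ 0)
    (hE : E.card ≤ m) (H : IsHopSpanner (2 * i) (Finset.range n) E) :
    invAck m n ≤ 2 * i + 3 := by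
  set h := Nat.log 2 n
  set M := ⌈(m : ℝ) / n⌉₊
  have hn_pos : (0 : ℝ) < n := by exact_mod_cast Nat.pos_of_ne_zero hn
  have hpow_le : 2 ^ h ≤ n := Nat.pow_log_le_self 2 hn
  have hlt_pow : n < 2 ^ (h + 1) := Nat.lt_pow_succ_log_self one_lt_two n
  have hM : M ≠ 0 := (Nat.ceil_pos.2 (by positivity)).ne'
  have hm_le : m ≤ M * n := by
    have := (div_le_iff₀ hn_pos).1 (Nat.le_ceil ((m : ℝ) / n))
    exact_mod_cast this
  have hdepth : h < hopDepth i (16 * M) := by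
    by_contra! hle
    have hforced := ForcesDegree.of_hopDepth_le hle 0 (Finset.range (2 ^ h)) E
      (fun x hx => Nat.div_eq_of_lt (Finset.mem_range.1 hx))
      (H.mono (Finset.range_subset_range.2 hpow_le))
    have hfew : 8 * E.card < 16 * M * 2 ^ h :=
      calc 8 * E.card ≤ 8 * (M * n) := by gcongr; exact hE.trans hm_le
        _ < 8 * (M * 2 ^ (h + 1)) := by gcongr
        _ = 16 * M * 2 ^ h := by ring
    rw [Finset.card_range, two_mul, mul_add] at hforced
    omega
  refine Nat.sInf_le ⟨by omega, ?_⟩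
  calc Real.logb 2 n ≤ ((h + 1 : ℕ) : ℝ) := by
        rw [Real.logb_le_iff_le_rpow one_lt_two hn_pos, Real.rpow_natCast]
        exact_mod_cast hlt_pow.le
    _ ≤ ackA (2 * i + 3) (4 * M) := by
        exact_mod_cast hdepth.trans_le (hopDepth_le_ackA_four_mul i hM)

/-! ### Sequences separated at every dyadic scale -/

/-- A finite sequence in a pseudometric space whose dyadic blocks of indices are separated from the
other terms at their own scale: whatever lies within `s * dist (x p) (x q)` of `x p` has its index
in every dyadic block that contains `p` and `q`. -/
def IsDyadicallySeparated {P : Type*} [PseudoMetricSpace P] {n : ℕ} (s : ℝ)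
    (x : Fin n → P) : Prop :=
  ∀ (l : ℕ) (p q v : Fin n), (p : ℕ) / 2 ^ l = q / 2 ^ l →
    dist (x p) (x v) ≤ s * dist (x p) (x q) → (v : ℕ) / 2 ^ l = p / 2 ^ l

namespace IsDyadicallySeparated

variable {P Q : Type*} [PseudoMetricSpace P] [PseudoMetricSpace Q] {n : ℕ} {s s' : ℝ}
  {x : Fin n → P}

theorem mono (hx : IsDyadicallySeparated s x) (hs : s' ≤ s) : IsDyadicallySeparated s' x :=
  fun l p q v hpq hv =>
    hx l p q v hpq (hv.trans (mul_le_mul_of_nonneg_right hs dist_nonneg))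

theorem of_dist_eq {y : Fin n → Q} (hx : IsDyadicallySeparated s x)
    (hy : ∀ p q, dist (y p) (y q) = dist (x p) (x q)) : IsDyadicallySeparated s y :=
  fun l p q v hpq hv => hx l p q v hpq (by rwa [hy, hy] at hv)

theorem injective {P : Type*} [MetricSpace P] {x : Fin n → P}
    (hx : IsDyadicallySeparated s x) : Function.Injective x := by
  intro p v hpv
  have := hx 0 p p v rfl (by simp [hpv])
  simpa [Fin.ext_iff] using this.symm

end IsDyadicallySeparated

/-- The number whose digits in base `R` are the binary digits of `p`. -/
noncomputable def spread (R : ℝ) (p : ℕ) : ℝ :=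
  Nat.ofDigits R (Nat.digits 2 p)

theorem spread_eq_mod_add (R : ℝ) (p : ℕ) : spread R p = (p % 2 : ℕ) + R * spread R (p / 2) := by
  rcases p.eq_zero_or_pos with rfl | hp
  · simp [spread, Nat.ofDigits]
  · rw [spread, Nat.digits_def' one_lt_two hp, Nat.ofDigits, spread]

theorem abs_spread_sub_mul_le (R : ℝ) (p q : ℕ) :
    |(spread R p - spread R q) - R * (spread R (p / 2) - spread R (q / 2))| ≤ 1 := by
  have hdigits : (spread R p - spread R q) - R * (spread R (p / 2) - spread R (q / 2))
      = (p % 2 : ℕ) - (q % 2 : ℕ) := by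
    rw [spread_eq_mod_add R p, spread_eq_mod_add R q]
    ring
  rw [hdigits]
  rcases Nat.mod_two_eq_zero_or_one p with hp | hp <;>
    rcases Nat.mod_two_eq_zero_or_one q with hq | hq <;> simp [hp, hq]

section Spread

variable {R : ℝ}

theorem abs_spread_sub_le (hR : 0 ≤ R) (p q : ℕ) :
    |spread R p - spread R q| ≤ R * |spread R (p / 2) - spread R (q / 2)| + 1 := by
  have h := (abs_sub_abs_le_abs_sub _ _).trans (abs_spread_sub_mul_le R p q)
  rw [abs_mul, abs_of_nonneg hR] at h
  linarith

theorem le_abs_spread_sub (hR : 0 ≤ R) (p q : ℕ) :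
    R * |spread R (p / 2) - spread R (q / 2)| - 1 ≤ |spread R p - spread R q| := by
  have h := (abs_sub_abs_le_abs_sub _ _).trans
    ((abs_sub_comm _ _).trans_le (abs_spread_sub_mul_le R p q))
  rw [abs_mul, abs_of_nonneg hR] at h
  linarith

theorem abs_spread_sub_le_of_div_eq (hR : 1 ≤ R) (l : ℕ) {p q : ℕ}
    (hpq : p / 2 ^ l = q / 2 ^ l) : (R - 1) * |spread R p - spread R q| ≤ R ^ l - 1 := by
  induction l generalizing p q with
  | zero => simp_all
  | succ l ih =>
    rw [add_comm, div_two_pow_add, div_two_pow_add, pow_one] at hpq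
    calc (R - 1) * |spread R p - spread R q|
        ≤ (R - 1) * (R * |spread R (p / 2) - spread R (q / 2)| + 1) := by
          gcongr
          exact abs_spread_sub_le (by linarith) p q
      _ = R * ((R - 1) * |spread R (p / 2) - spread R (q / 2)|) + (R - 1) := by ring
      _ ≤ R * (R ^ l - 1) + (R - 1) := by gcongr; exact ih hpq
      _ = R ^ (l + 1) - 1 := by ring

theorem one_le_abs_spread_sub (hR : 2 ≤ R) {p q : ℕ} (hpq : p ≠ q) :
    1 ≤ |spread R p - spread R q| := by
  wlog hlt : p < q generalizing p q
  · rw [abs_sub_comm]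
    exact this hpq.symm (by omega)
  clear hpq
  induction q using Nat.strong_induction_on generalizing p with
  | _ q ih =>
    rcases eq_or_ne (p / 2) (q / 2) with hdiv | hdiv
    · have hp : p % 2 = 0 := by omega
      have hq : q % 2 = 1 := by omega
      rw [spread_eq_mod_add R p, spread_eq_mod_add R q, hdiv, hp, hq]
      simp
    · have hhalf := ih (q / 2) (by omega) (p := p / 2) (by omega)
      calc 1 ≤ R * 1 - 1 := by linarith
        _ ≤ R * |spread R (p / 2) - spread R (q / 2)| - 1 := by gcongr
        _ ≤ |spread R p - spread R q| := le_abs_spread_sub (by linarith) p q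

theorem le_abs_spread_sub_of_div_ne (hR : 2 ≤ R) (l : ℕ) {p q : ℕ}
    (hpq : p / 2 ^ l ≠ q / 2 ^ l) :
    (R - 2) * R ^ l + 1 ≤ (R - 1) * |spread R p - spread R q| := by
  induction l generalizing p q with
  | zero =>
    have := one_le_abs_spread_sub hR (by simpa using hpq)
    nlinarith
  | succ l ih =>
    rw [add_comm, div_two_pow_add, div_two_pow_add, pow_one] at hpq
    calc (R - 2) * R ^ (l + 1) + 1 = R * ((R - 2) * R ^ l + 1) - (R - 1) := by ring
      _ ≤ R * ((R - 1) * |spread R (p / 2) - spread R (q / 2)|) - (R - 1) := by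
        gcongr
        exact ih hpq
      _ = (R - 1) * (R * |spread R (p / 2) - spread R (q / 2)| - 1) := by ring
      _ ≤ (R - 1) * |spread R p - spread R q| := by
        gcongr
        · linarith
        · exact le_abs_spread_sub (by linarith) p q

theorem isDyadicallySeparated_spread (hR : 2 ≤ R) (n : ℕ) :
    IsDyadicallySeparated (R - 2) fun i : Fin n => spread R i := by
  intro l p q v hpq hv
  by_contra! hne
  simp only [Real.dist_eq] at hv
  have hlower := le_abs_spread_sub_of_div_ne hR l hne.symm
  have hupper :=
    calc (R - 1) * |spread R p - spread R v|
        ≤ (R - 1) * ((R - 2) * |spread R p - spread R q|) := by gcongr; linarith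
      _ = (R - 2) * ((R - 1) * |spread R p - spread R q|) := by ring
      _ ≤ (R - 2) * (R ^ l - 1) := by
        gcongr
        exact abs_spread_sub_le_of_div_eq (by linarith) l hpq
  linarith

end Spread

/-! ### From Steiner spanners to hop spanners -/

section Walk

variable {P : Type*} [MetricSpace P] {V : Set P} {H : SimpleGraph V} {t : ℝ} {X : Set P}

theorem walkWeight_cons {u v w : V} (huv : H.Adj u v) (p : H.Walk v w) :
    walkWeight (p.cons huv) = dist (u : P) v + walkWeight p := by
  simp [walkWeight]

theorem walkWeight_nonneg {u v : V} (w : H.Walk u v) : 0 ≤ walkWeight w :=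
  List.sum_nonneg (by simp)

theorem dist_getVert_le_walkWeight {u v : V} (w : H.Walk u v) (i : ℕ) :
    dist (u : P) (w.getVert i) ≤ walkWeight w := by
  induction w generalizing i with
  | nil => simp [walkWeight]
  | cons huv w ih =>
    rw [walkWeight_cons]
    cases i with
    | zero => simpa using add_nonneg dist_nonneg (walkWeight_nonneg w)
    | succ i =>
      rw [SimpleGraph.Walk.getVert_cons_succ]
      exact (dist_triangle _ _ _).trans (add_le_add_right (ih i) _)

theorem exists_isSpannerPath_length_le {k : ℕ} (hk : spannerDiameter t X H ≤ k) {p q : V}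
    (hp : (p : P) ∈ X) (hq : (q : P) ∈ X) (hpq : p ≠ q) :
    ∃ w : H.Walk p q, IsSpannerPath t w ∧ w.length ≤ k := by
  simp only [spannerDiameter, iSup_le_iff] at hk
  have hlt := (hk p q hp hq hpq).trans_lt (Nat.cast_lt.2 k.lt_succ_self)
  simp only [iInf_lt_iff, Nat.cast_lt, Nat.lt_succ_iff] at hlt
  obtain ⟨w, hw, hlen⟩ := hlt
  exact ⟨w, hw, hlen⟩

theorem isHop_getVert {V : Type*} {H : SimpleGraph V} (hfin : H.edgeSet.Finite) {u v : V}
    (w : H.Walk u v) (i : ℕ) : IsHop hfin.toFinset (w.getVert i) (w.getVert (i + 1)) := by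
  rcases lt_or_ge i w.length with hi | hi
  · exact .inr (hfin.mem_toFinset.2 (w.adj_getVert_succ hi))
  · rw [w.getVert_of_length_le hi, w.getVert_of_length_le (hi.trans i.le_succ)]
    exact .inl rfl

/-- Moving every vertex to the nearest point of the sequence turns a short walk into
one that stays in the dyadic block of its ends. -/
theorem exists_isHopSpanner {k m n : ℕ} [NeZero n] {x : Fin n → V}
    (hx : IsDyadicallySeparated (2 * t) fun i => (x i : P))
    (hwalk : ∀ p q, ∃ w : H.Walk (x p) (x q),
      walkWeight w ≤ t * dist (x p : P) (x q) ∧ w.length ≤ k)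
    (hm : H.edgeSet.encard ≤ m) :
    ∃ E : Finset (Sym2 ℕ), E.card ≤ m ∧ IsHopSpanner k (Finset.range n) E := by
  have hnearest (v : V) : ∃ i, ∀ p, dist (v : P) (x i) ≤ dist (v : P) (x p) :=
    Finite.exists_min fun i => dist (v : P) (x i)
  choose c hc using hnearest
  have hfix (p : Fin n) : c (x p) = p :=
    (hx.injective (dist_le_zero.1 ((hc (x p) p).trans_eq (dist_self _)))).symm
  have hfin : H.edgeSet.Finite := Set.finite_of_encard_le_coe hm
  refine ⟨hfin.toFinset.image (Sym2.map fun v => (c v : ℕ)), ?_, ?_⟩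
  · rw [hfin.encard_eq_coe_toFinset_card, Nat.cast_le] at hm
    exact Finset.card_image_le.trans hm
  intro p hp q hq l hpq
  lift p to Fin n using Finset.mem_range.1 hp
  lift q to Fin n using Finset.mem_range.1 hq
  obtain ⟨w, hw, hlen⟩ := hwalk p q
  refine ⟨fun i => c (w.getVert i), by simp [hfix], by simp [w.getVert_of_length_le hlen, hfix],
    fun i _ => (isHop_getVert hfin w i).image _, fun i _ => hx l p q _ hpq ?_⟩
  set v := w.getVert i
  calc dist (x p : P) (x (c v)) ≤ dist (x p : P) v + dist (v : P) (x (c v)) := dist_triangle _ _ _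
    _ ≤ dist (x p : P) v + dist (x p : P) v := by
      gcongr
      exact (hc v p).trans_eq (dist_comm _ _)
    _ ≤ 2 * walkWeight w := by linarith [dist_getVert_le_walkWeight w i]
    _ ≤ 2 * t * dist (x p : P) (x q) := by linarith

theorem invAck_le_five_mul_spannerDiameter {m n : ℕ} {x : Fin n → P} (hn : 2 ≤ n)
    (hx : IsDyadicallySeparated (2 * t) x) (hV : Set.range x ⊆ V) (hm : H.edgeSet.encard ≤ m) :
    (invAck m n : ℕ∞) ≤ 5 * spannerDiameter t (Set.range x) H := by
  have : NeZero n := ⟨by omega⟩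
  induction hD : spannerDiameter t (Set.range x) H using ENat.recTopCoe with
  | top => simp
  | coe k =>
    set y : Fin n → V := fun i => ⟨x i, hV ⟨i, rfl⟩⟩
    have hy : Function.Injective y := fun i j hij => hx.injective (congrArg Subtype.val hij)
    have hpath {i j : Fin n} (hij : i ≠ j) :
        ∃ w : H.Walk (y i) (y j), IsSpannerPath t w ∧ w.length ≤ k :=
      exists_isSpannerPath_length_le hD.le ⟨i, rfl⟩ ⟨j, rfl⟩ (hy.ne hij)
    have h01 : (⟨0, by omega⟩ : Fin n) ≠ ⟨1, by omega⟩ := by simp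
    obtain ⟨w, -, hlen⟩ := hpath h01
    have hw : ¬ w.Nil := fun hnil => hy.ne h01 hnil.eq
    have hk0 : k ≠ 0 := by
      rintro rfl
      exact hw (SimpleGraph.Walk.length_eq_zero_iff.1 (Nat.le_zero.1 hlen))
    have hm0 : m ≠ 0 := by
      rintro rfl
      have hempty : H.edgeSet = ∅ := Set.encard_eq_zero.1 (le_antisymm hm bot_le)
      exact hempty.subset (H.mem_edgeSet.2 (w.adj_snd hw))
    have hwalk (p q : Fin n) : ∃ w : H.Walk (y p) (y q),
        walkWeight w ≤ t * dist (y p : P) (y q) ∧ w.length ≤ 2 * ((k + 1) / 2) := by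
      rcases eq_or_ne p q with rfl | hpq
      · exact ⟨.nil, by simp [walkWeight], by simp⟩
      · obtain ⟨w, hw, hlen⟩ := hpath hpq
        exact ⟨w, hw.2, by omega⟩
    obtain ⟨E, hEm, hE⟩ := exists_isHopSpanner hx hwalk hm
    have hα := hE.invAck_le (NeZero.ne n) hm0 hEm
    exact_mod_cast (show invAck m n ≤ 5 * k by omega)

end Walk

universe u

theorem mainTheorem4_general :
    ∃ c : ℝ, 0 < c ∧
      ∀ (t : ℝ) (n : ℕ), 2 ≤ n →
        ∃ X : Finset ℝ, X.card = n ∧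
          ∀ {P : Type u} [MetricSpace P] {f : X → P}, Isometry f →
            ∀ (V : Set P) (H : SimpleGraph V) (m : ℕ),
              IsSteinerSpanner t (Set.range f) H →
              H.edgeSet.encard ≤ (m : ℕ∞) →
              ENNReal.ofReal (c * (invAck m n : ℝ)) ≤
                ((spannerDiameter t (Set.range f) H : ℕ∞) : ℝ≥0∞) := by
  refine ⟨1 / 5, by norm_num, fun t n hn => ?_⟩
  set x : Fin n → ℝ := fun i => spread (max 2 (2 * t + 2)) i
  have hx : IsDyadicallySeparated (2 * t) x :=
    (isDyadicallySeparated_spread (le_max_left _ _) n).mono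
      (le_sub_iff_add_le.2 (le_max_right _ _))
  refine ⟨Finset.univ.image x, ?_, fun {P} _ f hf V H m hH hm => ?_⟩
  · rw [Finset.card_image_of_injective _ hx.injective, Finset.card_fin]
  set e : Fin n → Finset.univ.image x := fun i =>
    ⟨x i, Finset.mem_image_of_mem x (Finset.mem_univ i)⟩
  have he : Function.Surjective e := by
    rintro ⟨_, hy⟩
    obtain ⟨i, -, rfl⟩ := Finset.mem_image.1 hy
    exact ⟨i, rfl⟩
  rw [← he.range_comp f] at hH ⊢
  have hα : ((invAck m n : ℕ∞) : ℝ≥0∞) ≤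
      ((5 * spannerDiameter t (Set.range (f ∘ e)) H : ℕ∞) : ℝ≥0∞) :=
    ENat.toENNReal_le.2 <|
      invAck_le_five_mul_spannerDiameter hn (hx.of_dist_eq fun p q => hf.dist_eq _ _) hH.subset hm
  rw [one_div_mul_eq_div, ENNReal.ofReal_div_of_pos (by norm_num), ENNReal.ofReal_natCast]
  exact ENNReal.div_le_of_le_mul' (by simpa using hα)

theorem mainTheorem4 :
    ∃ c : ℝ, 0 < c ∧
      ∀ ε : ℝ, 0 < ε → ∀ n : ℕ, 2 ≤ n →
        ∃ X : Finset ℝ, X.card = n ∧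
          ∀ (d : ℕ) [NeZero d] (V : Set (EuclideanSpace ℝ (Fin d))) (H : SimpleGraph V) (m : ℕ),
            IsSteinerSpanner (1 + ε) (onXAxis d (X : Set ℝ)) H →
            H.edgeSet.encard ≤ (m : ℕ∞) →
            ENNReal.ofReal (c * (invAck m n : ℝ)) ≤
              ((spannerDiameter (1 + ε) (onXAxis d (X : Set ℝ)) H : ℕ∞) : ℝ≥0∞) := by
  obtain ⟨c, hc, hbound⟩ := mainTheorem4_general
  refine ⟨c, hc, fun ε _ n hn => ?_⟩
  obtain ⟨X, hcard, hX⟩ := hbound (1 + ε) n hn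
  refine ⟨X, hcard, fun d _ => ?_⟩
  rw [onXAxis, Set.image_eq_range]
  exact hX (Isometry.of_dist_eq fun x y => PiLp.dist_single_same 2 (fun _ => ℝ) 0 (x : ℝ) y)
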